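/- Let $X_n$ ($n = 1, 2, \dots$) and $X$ be real-valued random variables, possibly defined on different probability spaces. Suppose that for every $n$: 1. $X_n$ has the same distribution as $-X_n$, and 2. $\mathbb{E}\left[\exp\left(b_n X_n^2\right)\right] < \infty$ for some $b_n > 0$ (which may depend on $n$). If $X_n$ converges in distribution to $X$ and $\mathbb{E}\left[\exp\left(b X^2\right)\right] = \infty$ for all $b > 0$, then for all but finitely many $n$ the moment generating function $z \mapsto \mathbb{E}\left[\exp\left(z X_n\right)\right]$, $z \in \mathbb{C}$, has some zeros that are not purely imaginary; that is, there is $z \in \mathbb{C}$ with $\operatorname{Re} z \neq 0$ such that $\exp(zX_n)$ is integrable and $\mathbb{E}\left[\exp\left(z X_n\right)\right] = 0$. -/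

import Mathlib

open MeasureTheory ProbabilityTheory Filter

/-!
If all zeros of `f z = 𝔼[exp (z X)]` are imaginary, the even function `f` is `f z = g (z ^ 2)` with
`g` entire, `log ‖g w‖ = o(‖w‖ ^ 2)`, and all zeros of `g` nonpositive. For `0 < s ≤ t`, Bernoulli's
inequality says that `1 + t / c ≤ (1 + s / c) ^ (t / s)` for each of the factors that the zeros
contribute to `g`; once the zeros in a large disc are divided out, the logarithm of the quotient
is almost linear near the origin (Borel-Carathéodory and Schwarz). Letting the disc grow,
`g t ≤ g s ^ (t / s)`, that is, `mgf t ≤ mgf s ^ (t ^ 2 / s ^ 2)`.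

In particular `mgf (2 * s) ≤ mgf s ^ 4`, so by Paley-Zygmund a variable with `mgf s = 2` has a tail
`ℙ(X > log (3 / 2) / s) ≥ 1 / 64`. Tightness therefore keeps `mgf ≤ 2` on a fixed interval for all
but finitely many of the variables, whence `mgf t ≤ 2 * exp (t ^ 2 / σ ^ 2)` with a common `σ`.
Integrating against a Gaussian in `t` bounds `𝔼[exp (σ ^ 2 X ^ 2 / 8)]` uniformly, and by Fatou the
bound passes to the limit in distribution.
-/

open scoped Topology

section ZeroExtraction

theorem norm_le_of_forall_mem_sphere_norm_le {f : ℂ → ℂ} {c : ℂ} {r C : ℝ} (hr : r ≠ 0)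
    (hf : DiffContOnCl ℂ f (Metric.ball c r)) (hC : ∀ z ∈ Metric.sphere c r, ‖f z‖ ≤ C) {z : ℂ}
    (hz : z ∈ Metric.closedBall c r) : ‖f z‖ ≤ C :=
  Complex.norm_le_of_forall_mem_frontier_norm_le Metric.isBounded_ball hf
    (by rwa [frontier_ball c hr]) (by rwa [closure_ball c hr])

theorem exists_differentiable_eq_sub_mul {f : ℂ → ℂ} (hf : Differentiable ℂ f) {u : ℂ}
    (hu : f u = 0) : ∃ g : ℂ → ℂ, Differentiable ℂ g ∧ ∀ z, f z = (z - u) * g z := by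
  refine ⟨dslope f u, ?_, fun z => ?_⟩
  · rw [← differentiableOn_univ]
    exact (Complex.differentiableOn_dslope univ_mem).2 hf.differentiableOn
  · simpa only [hu, sub_zero, smul_eq_mul] using (sub_smul_dslope f u z).symm

/-- The canonical product of genus zero with a zero at each member of `s`, counted with
multiplicity. A member `0` contributes the factor `1`, since `z / 0 = 0`. -/
noncomputable def genusZeroProd (s : Multiset ℂ) (z : ℂ) : ℂ :=
  (s.map fun u => 1 - z / u).prod

theorem genusZeroProd_cons (u : ℂ) (s : Multiset ℂ) (z : ℂ) :
    genusZeroProd (u ::ₘ s) z = (1 - z / u) * genusZeroProd s z := by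
  simp only [genusZeroProd, Multiset.map_cons, Multiset.prod_cons]

theorem genusZeroProd_apply_zero (s : Multiset ℂ) : genusZeroProd s 0 = 1 := by
  simp [genusZeroProd]

theorem genusZeroProd_eq_zero_of_mem {s : Multiset ℂ} {u : ℂ} (hus : u ∈ s) (hu : u ≠ 0) :
    genusZeroProd s u = 0 :=
  Multiset.prod_eq_zero (Multiset.mem_map.2 ⟨u, hus, by rw [div_self hu, sub_self]⟩)

theorem two_pow_card_le_norm_genusZeroProd {R : ℝ} {s : Multiset ℂ} (hs0 : ∀ u ∈ s, u ≠ 0)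
    (hsR : ∀ u ∈ s, ‖u‖ ≤ R) {z : ℂ} (hz : ‖z‖ = 3 * R) :
    2 ^ s.card ≤ ‖genusZeroProd s z‖ := by
  induction s using Multiset.induction_on with
  | empty => simp [genusZeroProd]
  | cons u s ih =>
    rw [Multiset.forall_mem_cons] at hs0 hsR
    have hfactor : 2 ≤ ‖1 - z / u‖ := by
      have hdiv : 3 ≤ ‖z / u‖ := by
        rw [norm_div, le_div_iff₀ (norm_pos_iff.2 hs0.1), hz]
        linarith [hsR.1]
      have htri := norm_sub_norm_le (z / u) 1
      rw [norm_one, norm_sub_rev] at htri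
      linarith
    rw [Multiset.card_cons, genusZeroProd_cons, norm_mul, pow_succ']
    gcongr
    exact ih hs0.2 hsR.2

/-- `f` is the product of the entire function `q` and the canonical product over `s`, a list with
multiplicity of some of the nonzero zeros of `f` in the closed disc of radius `R`. -/
structure IsZeroExtraction (f : ℂ → ℂ) (R : ℝ) (s : Multiset ℂ) (q : ℂ → ℂ) : Prop where
  differentiable : Differentiable ℂ q
  ne_zero : ∀ u ∈ s, u ≠ 0
  norm_le : ∀ u ∈ s, ‖u‖ ≤ R
  eq_mul : ∀ z, f z = genusZeroProd s z * q z

namespace IsZeroExtraction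

variable {f q : ℂ → ℂ} {R M : ℝ} {s : Multiset ℂ}

theorem refl (hf : Differentiable ℂ f) (R : ℝ) : IsZeroExtraction f R 0 f :=
  ⟨hf, by simp, by simp, by simp [genusZeroProd]⟩

theorem exists_cons (h : IsZeroExtraction f R s q) {u : ℂ} (hu0 : u ≠ 0) (huR : ‖u‖ ≤ R)
    (hqu : q u = 0) : ∃ q', IsZeroExtraction f R (u ::ₘ s) q' := by
  obtain ⟨g, hg, hqg⟩ := exists_differentiable_eq_sub_mul h.differentiable hqu
  refine ⟨fun z => -u * g z, by fun_prop, Multiset.forall_mem_cons.2 ⟨hu0, h.ne_zero⟩,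
    Multiset.forall_mem_cons.2 ⟨huR, h.norm_le⟩, fun z => ?_⟩
  rw [h.eq_mul, hqg, genusZeroProd_cons]
  field_simp
  ring

theorem apply_zero (h : IsZeroExtraction f R s q) : q 0 = f 0 := by
  rw [h.eq_mul, genusZeroProd_apply_zero, one_mul]

theorem eq_zero_of_mem (h : IsZeroExtraction f R s q) {u : ℂ} (hu : u ∈ s) : f u = 0 := by
  rw [h.eq_mul, genusZeroProd_eq_zero_of_mem hu (h.ne_zero u hu), zero_mul]

theorem two_pow_card_mul_norm_le (h : IsZeroExtraction f R s q) (hR : 0 < R)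
    (hM : ∀ z, ‖z‖ = 3 * R → ‖f z‖ ≤ M) {z : ℂ} (hz : ‖z‖ ≤ 3 * R) :
    2 ^ s.card * ‖q z‖ ≤ M := by
  rw [← le_div_iff₀' (by positivity)]
  refine norm_le_of_forall_mem_sphere_norm_le (r := 3 * R) (by positivity)
    h.differentiable.diffContOnCl (fun w hw => ?_) (mem_closedBall_zero_iff.2 hz)
  rw [mem_sphere_zero_iff_norm] at hw
  rw [le_div_iff₀' (by positivity)]
  calc 2 ^ s.card * ‖q w‖ ≤ ‖genusZeroProd s w‖ * ‖q w‖ := by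
        gcongr
        exact two_pow_card_le_norm_genusZeroProd h.ne_zero h.norm_le hw
    _ = ‖f w‖ := by rw [h.eq_mul, norm_mul]
    _ ≤ M := hM w hw

theorem exists_forall_ne_zero (hf : Differentiable ℂ f) (hf0 : f 0 ≠ 0) (hR : 0 < R) :
    ∃ s q, IsZeroExtraction f R s q ∧ ∀ z, ‖z‖ ≤ R → q z ≠ 0 := by
  by_contra! hcon
  have hcard (k : ℕ) : ∃ s q, IsZeroExtraction f R s q ∧ s.card = k := by
    induction k with
    | zero => exact ⟨0, f, refl hf R, Multiset.card_zero⟩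
    | succ k ih =>
      obtain ⟨s, q, h, hk⟩ := ih
      obtain ⟨u, huR, hqu⟩ := hcon s q h
      have hu0 : u ≠ 0 := by
        rintro rfl
        exact hf0 (h.apply_zero ▸ hqu)
      obtain ⟨q', h'⟩ := h.exists_cons hu0 huR hqu
      exact ⟨u ::ₘ s, q', h', by rw [Multiset.card_cons, hk]⟩
  obtain ⟨M, hM⟩ := (isCompact_sphere (0 : ℂ) (3 * R)).exists_bound_of_continuousOn
    hf.continuous.continuousOn
  obtain ⟨k, hk⟩ := pow_unbounded_of_one_lt (M / ‖f 0‖) (one_lt_two (α := ℝ))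
  obtain ⟨s, q, h, rfl⟩ := hcard k
  have hbound := h.two_pow_card_mul_norm_le hR (fun z hz => hM z (mem_sphere_zero_iff_norm.2 hz))
    (z := 0) (by rw [norm_zero]; positivity)
  rw [h.apply_zero, ← le_div_iff₀ (norm_pos_iff.2 hf0)] at hbound
  exact hk.not_ge hbound

end IsZeroExtraction

end ZeroExtraction

section Logarithm

theorem exists_differentiableOn_exp_eq {f : ℂ → ℂ} {c a : ℂ} {R : ℝ}
    (hf : DifferentiableOn ℂ f (Metric.ball c R)) (hne : ∀ z ∈ Metric.ball c R, f z ≠ 0)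
    (ha : Complex.exp a = f c) :
    ∃ H : ℂ → ℂ, DifferentiableOn ℂ H (Metric.ball c R) ∧ H c = a ∧
      ∀ z ∈ Metric.ball c R, Complex.exp (H z) = f z := by
  have hlogDeriv : DifferentiableOn ℂ (fun z => deriv f z / f z) (Metric.ball c R) :=
    (hf.deriv Metric.isOpen_ball).div hf hne
  obtain ⟨H, hHc, hH⟩ := hlogDeriv.isExactOn_ball.with_val_at c a
  have hquot : ∀ z ∈ Metric.ball c R, HasDerivAt (fun w => f w * Complex.exp (-H w)) 0 z := by
    intro z hz
    have hfz := (hf.differentiableAt (Metric.isOpen_ball.mem_nhds hz)).hasDerivAt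
    convert! hfz.mul (hH z hz).neg.cexp using 1
    have := hne z hz
    field_simp
    ring
  refine ⟨H, fun z hz => (hH z hz).differentiableAt.differentiableWithinAt, hHc, fun z hz => ?_⟩
  have hconst := Metric.isOpen_ball.is_const_of_deriv_eq_zero Metric.isPreconnected_ball
    (fun w hw => (hquot w hw).differentiableAt.differentiableWithinAt)
    (fun w hw => (hquot w hw).deriv) hz
    (Metric.mem_ball_self (dist_nonneg.trans_lt (Metric.mem_ball.1 hz)))
  rw [hHc, ← ha, ← Complex.exp_add, add_neg_cancel, Complex.exp_zero, Complex.exp_neg,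
    ← div_eq_mul_inv, div_eq_one_iff_eq (Complex.exp_ne_zero _)] at hconst
  exact hconst.symm

variable {H : ℂ → ℂ} {R M : ℝ}

theorem norm_dslope_zero_le_of_re_le (hH : DifferentiableOn ℂ H (Metric.ball 0 R)) (hH0 : H 0 = 0)
    (hre : ∀ z ∈ Metric.ball 0 R, (H z).re ≤ M) (hR : 0 < R) (hM : 0 < M) {z : ℂ}
    (hz : ‖z‖ ≤ R / 2) : ‖dslope H 0 z‖ ≤ 4 * M / R := by
  have hsub : Metric.closedBall (0 : ℂ) (R / 2) ⊆ Metric.ball 0 R :=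
    Metric.closedBall_subset_ball (half_lt_self hR)
  have hK : DifferentiableOn ℂ (dslope H 0) (Metric.ball 0 R) :=
    (Complex.differentiableOn_dslope (Metric.ball_mem_nhds 0 hR)).2 hH
  refine norm_le_of_forall_mem_sphere_norm_le (half_pos hR).ne'
    ((hK.mono hsub).diffContOnCl_ball subset_rfl) (fun w hw => ?_) (mem_closedBall_zero_iff.2 hz)
  have hBC := Complex.borelCaratheodory_zero hM hH hre hR
    (hsub (Metric.sphere_subset_closedBall hw)) hH0
  rw [mem_sphere_zero_iff_norm] at hw
  have hw0 : w ≠ 0 := norm_pos_iff.1 (hw ▸ half_pos hR)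
  rw [dslope_of_ne _ hw0, slope_def_field, hH0, sub_zero, sub_zero, norm_div, hw,
    div_le_iff₀ (half_pos hR)]
  refine hBC.trans_eq ?_
  rw [hw]
  field_simp
  ring

theorem norm_dslope_zero_sub_le_of_re_le (hH : DifferentiableOn ℂ H (Metric.ball 0 R))
    (hH0 : H 0 = 0) (hre : ∀ z ∈ Metric.ball 0 R, (H z).re ≤ M) (hR : 0 < R) (hM : 0 < M)
    {z : ℂ} (hz : ‖z‖ < R / 2) :
    ‖dslope H 0 z - dslope H 0 0‖ ≤ 16 * M / R ^ 2 * ‖z‖ := by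
  have hK : DifferentiableOn ℂ (dslope H 0) (Metric.ball 0 (R / 2)) :=
    ((Complex.differentiableOn_dslope (Metric.ball_mem_nhds 0 hR)).2 hH).mono
      (Metric.ball_subset_ball (half_le_self hR.le))
  have hmaps : Set.MapsTo (dslope H 0) (Metric.ball 0 (R / 2))
      (Metric.closedBall (dslope H 0 0) (8 * M / R)) := fun w hw => by
    have hKw := norm_dslope_zero_le_of_re_le hH hH0 hre hR hM (mem_ball_zero_iff.1 hw).le
    have hK0 := norm_dslope_zero_le_of_re_le hH hH0 hre hR hM
      (norm_zero.trans_le (half_pos hR).le)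
    rw [mem_closedBall_iff_norm]
    calc ‖dslope H 0 w - dslope H 0 0‖ ≤ 4 * M / R + 4 * M / R :=
          (norm_sub_le _ _).trans (add_le_add hKw hK0)
      _ = 8 * M / R := by ring
  have hSchwarz := Complex.dist_le_div_mul_dist_of_mapsTo_ball hK hmaps (mem_ball_zero_iff.2 hz)
  rw [dist_eq_norm, dist_zero_right] at hSchwarz
  refine hSchwarz.trans_eq ?_
  field_simp
  ring

theorem norm_le_rpow_mul_exp_of_ne_zero {q : ℂ → ℂ} (hq : DifferentiableOn ℂ q (Metric.ball 0 R))
    (hq0 : q 0 = 1) (hne : ∀ z ∈ Metric.ball 0 R, q z ≠ 0) (hM : 0 < M)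
    (hbound : ∀ z ∈ Metric.ball 0 R, ‖q z‖ ≤ Real.exp M) {s t : ℝ} (hs : 0 < s) (hst : s ≤ t)
    (htR : t < R / 2) :
    ‖q t‖ ≤ ‖q s‖ ^ (t / s) * Real.exp (32 * M * t ^ 2 / R ^ 2) := by
  have ht : 0 < t := hs.trans_le hst
  have hR : 0 < R := by linarith
  obtain ⟨H, hH, hH0, hexp⟩ :=
    exists_differentiableOn_exp_eq hq hne (Complex.exp_zero.trans hq0.symm)
  have hre : ∀ z ∈ Metric.ball 0 R, (H z).re ≤ M := fun z hz => by
    have := hbound z hz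
    rwa [← hexp z hz, Complex.norm_exp, Real.exp_le_exp] at this
  set K := dslope H 0
  have hnorm : ∀ x : ℝ, 0 < x → x ≤ t → ‖q x‖ = Real.exp (x * (K x).re) := fun x hx hxt => by
    have hHK : H x = x * K x := by
      simpa only [hH0, sub_zero, smul_eq_mul] using (sub_smul_dslope H 0 x).symm
    have hxR : (x : ℂ) ∈ Metric.ball 0 R := by
      rw [mem_ball_zero_iff, Complex.norm_of_nonneg hx.le]
      linarith
    rw [← hexp x hxR, Complex.norm_exp, hHK, Complex.re_ofReal_mul]
  have hosc : ∀ x : ℝ, 0 < x → x ≤ t → ‖K x - K 0‖ ≤ 16 * M / R ^ 2 * t := fun x hx hxt => by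
    have hxnorm : ‖(x : ℂ)‖ = x := Complex.norm_of_nonneg hx.le
    refine (norm_dslope_zero_sub_le_of_re_le hH hH0 hre hR hM (by linarith)).trans ?_
    rw [hxnorm]
    gcongr
  have hK : (K t).re ≤ (K s).re + 32 * M / R ^ 2 * t := by
    have htri := norm_sub_le (K t - K 0) (K s - K 0)
    have hre := Complex.re_le_norm (K t - K s)
    rw [sub_sub_sub_cancel_right] at htri
    rw [Complex.sub_re] at hre
    linarith [hosc t ht le_rfl, hosc s hs hst, show 32 * M / R ^ 2 * t =
      16 * M / R ^ 2 * t + 16 * M / R ^ 2 * t by ring]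
  rw [hnorm t ht le_rfl, hnorm s hs hst, ← Real.exp_mul, ← Real.exp_add, Real.exp_le_exp]
  calc t * (K t).re ≤ t * ((K s).re + 32 * M / R ^ 2 * t) := by gcongr
    _ = s * (K s).re * (t / s) + 32 * M * t ^ 2 / R ^ 2 := by field_simp

end Logarithm

section NonposZeros

open scoped ComplexOrder

theorem norm_one_sub_div_le_rpow {u : ℂ} (hu : u ≤ 0) {s t : ℝ} (hs : 0 < s) (hst : s ≤ t) :
    ‖1 - t / u‖ ≤ ‖1 - s / u‖ ^ (t / s) := by
  obtain ⟨c, hc, rfl⟩ : ∃ c : ℝ, 0 ≤ c ∧ u = -c :=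
    ⟨-u.re, neg_nonneg.2 (Complex.nonpos_iff.1 hu).1,
      Complex.ext (by simp) (by simpa using (Complex.nonpos_iff.1 hu).2)⟩
  have hnorm : ∀ x : ℝ, 0 ≤ x → ‖1 - (x : ℂ) / -(c : ℂ)‖ = 1 + x / c := fun x hx => by
    rw [div_neg, sub_neg_eq_add, ← Complex.norm_of_nonneg (show 0 ≤ 1 + x / c by positivity)]
    push_cast
    rfl
  rw [hnorm t (hs.le.trans hst), hnorm s hs.le]
  have hbernoulli := one_add_mul_self_le_rpow_one_add (s := s / c)
    (by linarith [show 0 ≤ s / c by positivity]) ((one_le_div hs).2 hst)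
  rwa [div_mul_div_cancel₀ hs.ne'] at hbernoulli

theorem norm_genusZeroProd_le_rpow {S : Multiset ℂ} (hS : ∀ u ∈ S, u ≤ 0) {s t : ℝ} (hs : 0 < s)
    (hst : s ≤ t) : ‖genusZeroProd S t‖ ≤ ‖genusZeroProd S s‖ ^ (t / s) := by
  induction S using Multiset.induction_on with
  | empty => simp [genusZeroProd]
  | cons u S ih =>
    rw [Multiset.forall_mem_cons] at hS
    rw [genusZeroProd_cons, genusZeroProd_cons, norm_mul, norm_mul,
      Real.mul_rpow (norm_nonneg _) (norm_nonneg _)]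
    gcongr
    · exact norm_one_sub_div_le_rpow hS.1 hs hst
    · exact ih hS.2

variable {g : ℂ → ℂ} {s t : ℝ}

theorem norm_le_rpow_mul_exp_of_zeros_nonpos (hg : Differentiable ℂ g) (hg0 : g 0 = 1)
    (hzeros : ∀ w, g w = 0 → w ≤ 0) {R M : ℝ} (hM : 0 < M)
    (hbound : ∀ w, ‖w‖ = 3 * R → ‖g w‖ ≤ Real.exp M) (hs : 0 < s) (hst : s ≤ t)
    (htR : t < R / 2) :
    ‖g t‖ ≤ ‖g s‖ ^ (t / s) * Real.exp (32 * M * t ^ 2 / R ^ 2) := by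
  have hR : 0 < R := by linarith
  obtain ⟨S, q, h, hq⟩ :=
    IsZeroExtraction.exists_forall_ne_zero hg (hg0 ▸ one_ne_zero) hR
  have hqbound : ∀ z ∈ Metric.ball 0 R, ‖q z‖ ≤ Real.exp M := fun z hz =>
    (le_mul_of_one_le_left (norm_nonneg _) (one_le_pow₀ one_le_two)).trans
      (h.two_pow_card_mul_norm_le hR hbound (by linarith [mem_ball_zero_iff.1 hz]))
  have hprod := norm_genusZeroProd_le_rpow (fun u hu => hzeros u (h.eq_zero_of_mem hu)) hs hst
  have hquot := norm_le_rpow_mul_exp_of_ne_zero h.differentiable.differentiableOn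
    (h.apply_zero.trans hg0) (fun z hz => hq z (mem_ball_zero_iff.1 hz).le) hM hqbound hs hst htR
  rw [h.eq_mul t, h.eq_mul s, norm_mul, norm_mul, Real.mul_rpow (norm_nonneg _) (norm_nonneg _),
    mul_assoc]
  gcongr

theorem norm_le_rpow_of_zeros_nonpos (hg : Differentiable ℂ g) (hg0 : g 0 = 1)
    (hzeros : ∀ w, g w = 0 → w ≤ 0) {M : ℝ → ℝ} (hM : M =o[atTop] fun r => r ^ 2)
    (hbound : ∀ w, ‖g w‖ ≤ Real.exp (M ‖w‖)) (hs : 0 < s) (hst : s ≤ t) :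
    ‖g t‖ ≤ ‖g s‖ ^ (t / s) := by
  have hdisc : ∀ᶠ R in atTop, ‖g t‖ ≤
      ‖g s‖ ^ (t / s) * Real.exp (32 * (|M (3 * R)| + 1) * t ^ 2 / R ^ 2) := by
    filter_upwards [eventually_gt_atTop (2 * t)] with R hR
    refine norm_le_rpow_mul_exp_of_zeros_nonpos hg hg0 hzeros (by positivity) (fun w hw => ?_)
      hs hst (by linarith)
    refine (hbound w).trans (Real.exp_le_exp.2 ?_)
    rw [hw]
    linarith [le_abs_self (M (3 * R))]
  have hgrowth : Tendsto (fun R => 32 * (|M (3 * R)| + 1) * t ^ 2 / R ^ 2) atTop (𝓝 0) := by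
    have hM3 : (fun R => |M (3 * R)|) =o[atTop] fun R : ℝ => R ^ 2 := by
      refine ((hM.comp_tendsto (tendsto_id.const_mul_atTop three_pos)).abs_left).trans_isBigO ?_
      simp only [Function.comp_def, id_eq, mul_pow]
      exact (Asymptotics.isBigO_refl _ _).const_mul_left _
    have hone : (fun _ : ℝ => (1 : ℝ)) =o[atTop] fun R : ℝ => R ^ 2 :=
      Asymptotics.isLittleO_const_left.2 (Or.inr (tendsto_norm_atTop_atTop.comp
        (tendsto_pow_atTop two_ne_zero)))
    refine ((hM3.add hone).const_mul_left (32 * t ^ 2)).tendsto_div_nhds_zero.congr fun R => ?_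
    ring
  have hlim := (Real.continuous_exp.tendsto 0).comp hgrowth |>.const_mul (‖g s‖ ^ (t / s))
  rw [Real.exp_zero, mul_one] at hlim
  exact ge_of_tendsto hlim hdisc

end NonposZeros

section EvenFunctions

theorem exists_differentiable_comp_sq_of_even {f : ℂ → ℂ} (hf : Differentiable ℂ f)
    (heven : ∀ z, f (-z) = f z) : ∃ g : ℂ → ℂ, Differentiable ℂ g ∧ ∀ z, f z = g (z ^ 2) := by
  have heq {a b : ℂ} (h : a ^ 2 = b ^ 2) : f a = f b := by
    rcases sq_eq_sq_iff_eq_or_eq_neg.1 h with rfl | rfl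
    exacts [rfl, heven b]
  let root : ℂ → ℂ := fun w => w ^ (2⁻¹ : ℂ)
  have hroot (w : ℂ) : root w ^ 2 = w := Complex.cpow_nat_inv_pow w two_ne_zero
  have hslit {w : ℂ} (hw : w ∈ Complex.slitPlane) : DifferentiableAt ℂ root w :=
    differentiableAt_id.cpow_const hw
  have hdiff {w : ℂ} (hw : w ≠ 0) : DifferentiableAt ℂ (f ∘ root) w := by
    by_cases hws : w ∈ Complex.slitPlane
    · exact (hf _).comp w (hslit hws)
    -- On the branch cut the other branch `I * √(-w)` serves, since `f` is even.
    · have hws' : -w ∈ Complex.slitPlane :=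
        (Complex.mem_slitPlane_or_neg_mem_slitPlane hw).resolve_left hws
      have hbranch : f ∘ root = fun w => f (Complex.I * root (-w)) := funext fun w =>
        heq (by rw [hroot, mul_pow, Complex.I_sq, hroot, neg_one_mul, neg_neg])
      rw [hbranch]
      exact (hf _).comp w (((hslit hws').comp w differentiableAt_id.neg).const_mul _)
  have hcont : ContinuousAt (f ∘ root) 0 :=
    hf.continuous.continuousAt.comp
      (Complex.continuousAt_cpow_const_of_re_pos (Or.inl le_rfl) (by norm_num))
  refine ⟨f ∘ root, fun w => ?_, fun z => heq (hroot _).symm⟩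
  rcases eq_or_ne w 0 with rfl | hw
  · exact (Complex.analyticAt_of_differentiable_on_punctured_nhds_of_continuousAt
      (eventually_mem_nhdsWithin.mono fun w hw => hdiff hw) hcont).differentiableAt
  · exact hdiff hw

end EvenFunctions

section PaleyZygmund

variable {Ω : Type*} [MeasurableSpace Ω] {P : Measure Ω} {Z : Ω → ℝ}

theorem sq_integral_le_integral_sq_mul_measureReal_univ [IsFiniteMeasure P] (hZ : MemLp Z 2 P) :
    (∫ ω, Z ω ∂P) ^ 2 ≤ (∫ ω, Z ω ^ 2 ∂P) * P.real Set.univ := by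
  have hZ1 : Integrable Z P := hZ.integrable one_le_two
  have hquad (x : ℝ) :
      0 ≤ P.real Set.univ * (x * x) + 2 * (∫ ω, Z ω ∂P) * x + ∫ ω, Z ω ^ 2 ∂P := by
    calc 0 ≤ ∫ ω, (x * x + 2 * x * Z ω + Z ω ^ 2) ∂P :=
          integral_nonneg fun ω => (sq_nonneg (x + Z ω)).trans_eq (by ring)
      _ = ∫ ω, (x * x + 2 * x * Z ω) ∂P + ∫ ω, Z ω ^ 2 ∂P :=
        integral_add ((integrable_const _).add (hZ1.const_mul _)) hZ.integrable_sq
      _ = P.real Set.univ * (x * x) + 2 * (∫ ω, Z ω ∂P) * x + ∫ ω, Z ω ^ 2 ∂P := by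
        rw [integral_add (integrable_const _) (hZ1.const_mul _), integral_const, smul_eq_mul,
          integral_const_mul]
        ring
  have hdiscrim := discrim_le_zero hquad
  rw [discrim] at hdiscrim
  linarith

theorem sq_integral_sub_le_integral_sq_mul_measureReal_lt [IsProbabilityMeasure P]
    (hZ : MemLp Z 2 P) {θ : ℝ} (hθ : 0 ≤ θ) (hθZ : θ ≤ ∫ ω, Z ω ∂P) :
    (∫ ω, Z ω ∂P - θ) ^ 2 ≤ (∫ ω, Z ω ^ 2 ∂P) * P.real {ω | θ < Z ω} := by
  have hmeas : NullMeasurableSet {ω | θ < Z ω} P :=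
    nullMeasurableSet_lt aemeasurable_const hZ.1.aemeasurable
  have hint : Integrable Z P := hZ.integrable one_le_two
  have hcompl : ∫ ω in {ω | θ < Z ω}ᶜ, Z ω ∂P ≤ θ := by
    calc ∫ ω in {ω | θ < Z ω}ᶜ, Z ω ∂P ≤ ∫ _ in {ω | θ < Z ω}ᶜ, θ ∂P :=
          setIntegral_mono_on₀ hint.integrableOn (integrable_const θ).integrableOn hmeas.compl
            fun ω hω => not_lt.1 hω
      _ = P.real {ω | θ < Z ω}ᶜ * θ := by rw [setIntegral_const, smul_eq_mul]
      _ ≤ θ := mul_le_of_le_one_left hθ measureReal_le_one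
  calc (∫ ω, Z ω ∂P - θ) ^ 2 ≤ (∫ ω in {ω | θ < Z ω}, Z ω ∂P) ^ 2 :=
        pow_le_pow_left₀ (sub_nonneg.2 hθZ) (by linarith [integral_add_compl₀ hmeas hint]) 2
    _ ≤ (∫ ω in {ω | θ < Z ω}, Z ω ^ 2 ∂P) * P.real {ω | θ < Z ω} := by
      simpa only [measureReal_restrict_apply_univ] using
        sq_integral_le_integral_sq_mul_measureReal_univ (hZ.restrict {ω | θ < Z ω})
    _ ≤ (∫ ω, Z ω ^ 2 ∂P) * P.real {ω | θ < Z ω} := by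
      refine mul_le_mul_of_nonneg_right ?_ measureReal_nonneg
      exact setIntegral_le_integral hZ.integrable_sq (ae_of_all _ fun _ => sq_nonneg _)

end PaleyZygmund

section Symmetric

open scoped ComplexOrder

variable {Ω : Type*} [MeasurableSpace Ω] {P : Measure Ω} {X : Ω → ℝ}

theorem mgf_neg_of_identDistrib_neg (hsymm : IdentDistrib X (-X) P P) (t : ℝ) :
    mgf X P (-t) = mgf X P t := by
  rw [← mgf_neg, ← mgf_congr_identDistrib hsymm]

theorem complexMGF_neg_of_identDistrib_neg (hsymm : IdentDistrib X (-X) P P) (z : ℂ) :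
    complexMGF X P (-z) = complexMGF X P z := by
  conv_rhs => rw [complexMGF_congr_identDistrib hsymm]
  simp [complexMGF]

theorem mgf_eq_integral_cosh (hsymm : IdentDistrib X (-X) P P)
    (hint : ∀ t, Integrable (fun ω => Real.exp (t * X ω)) P) (t : ℝ) :
    mgf X P t = ∫ ω, Real.cosh (t * X ω) ∂P := by
  calc mgf X P t = (mgf X P t + mgf X P (-t)) / 2 := by
        rw [mgf_neg_of_identDistrib_neg hsymm, add_self_div_two]
    _ = ∫ ω, Real.cosh (t * X ω) ∂P := by
      simp_rw [mgf, ← integral_add (hint t) (hint (-t)), ← integral_div, Real.cosh_eq, neg_mul]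

theorem mgf_le_mgf_of_abs_le (hsymm : IdentDistrib X (-X) P P)
    (hint : ∀ t, Integrable (fun ω => Real.exp (t * X ω)) P) {s t : ℝ} (hst : |s| ≤ |t|) :
    mgf X P s ≤ mgf X P t := by
  have hcosh (t : ℝ) : Integrable (fun ω => Real.cosh (t * X ω)) P := by
    simp_rw [Real.cosh_eq, ← neg_mul]
    exact ((hint t).add (hint (-t))).div_const 2
  rw [mgf_eq_integral_cosh hsymm hint, mgf_eq_integral_cosh hsymm hint]
  refine integral_mono (hcosh s) (hcosh t) fun ω => Real.cosh_le_cosh.2 ?_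
  rw [abs_mul, abs_mul]
  gcongr

theorem differentiable_complexMGF (hint : ∀ t, Integrable (fun ω => Real.exp (t * X ω)) P) :
    Differentiable ℂ (complexMGF X P) := by
  have huniv : integrableExpSet X P = Set.univ := Set.eq_univ_of_forall hint
  rw [← differentiableOn_univ]
  simpa [huniv] using differentiableOn_complexMGF (X := X) (μ := P)

theorem norm_complexMGF_le_exp_cgf_norm [NeZero P] (hsymm : IdentDistrib X (-X) P P)
    (hint : ∀ t, Integrable (fun ω => Real.exp (t * X ω)) P) (z : ℂ) :
    ‖complexMGF X P z‖ ≤ Real.exp (cgf X P ‖z‖) := by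
  rw [exp_cgf (hint _)]
  refine norm_complexMGF_le_mgf.trans (mgf_le_mgf_of_abs_le hsymm hint ?_)
  rw [abs_norm]
  exact Complex.abs_re_le_norm z

theorem mgf_le_rpow_of_complexMGF_zeros_imaginary [IsProbabilityMeasure P]
    (hsymm : IdentDistrib X (-X) P P) (hint : ∀ t, Integrable (fun ω => Real.exp (t * X ω)) P)
    (hgrowth : cgf X P =o[atTop] fun t => t ^ 4)
    (hzeros : ∀ z, complexMGF X P z = 0 → z.re = 0) {s t : ℝ} (hs : 0 < s) (hst : s ≤ t) :
    mgf X P t ≤ mgf X P s ^ (t ^ 2 / s ^ 2) := by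
  obtain ⟨g, hg, hfg⟩ := exists_differentiable_comp_sq_of_even (differentiable_complexMGF hint)
    (complexMGF_neg_of_identDistrib_neg hsymm)
  have hgmgf (x : ℝ) : ‖g ↑(x ^ 2)‖ = mgf X P x := by
    rw [Complex.ofReal_pow, ← hfg, complexMGF_ofReal, Complex.norm_of_nonneg mgf_nonneg]
  have hg0 : g 0 = 1 := by
    rw [← zero_pow two_ne_zero, ← hfg, ← Complex.ofReal_zero, complexMGF_ofReal, mgf_zero,
      Complex.ofReal_one]
  have hroot (w : ℂ) : ∃ z, z ^ 2 = w := IsAlgClosed.exists_pow_nat_eq w two_pos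
  have hgzeros (w : ℂ) (hw : g w = 0) : w ≤ 0 := by
    obtain ⟨z, rfl⟩ := hroot w
    have hre : z.re = 0 := hzeros z ((hfg z).trans hw)
    rw [Complex.nonpos_iff, sq, Complex.mul_re, Complex.mul_im, hre]
    exact ⟨by linarith [mul_self_nonneg z.im], by ring⟩
  have hgrowth' : (fun r => cgf X P (√r)) =o[atTop] fun r => r ^ 2 := by
    refine (hgrowth.comp_tendsto Real.tendsto_sqrt_atTop).congr' .rfl ?_
    filter_upwards [eventually_ge_atTop 0] with r hr
    rw [Function.comp_apply, show 4 = 2 * 2 by rfl, pow_mul, Real.sq_sqrt hr]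
  have hbound (w : ℂ) : ‖g w‖ ≤ Real.exp (cgf X P (√‖w‖)) := by
    obtain ⟨z, rfl⟩ := hroot w
    rw [← hfg, norm_pow, Real.sqrt_sq (norm_nonneg z)]
    exact norm_complexMGF_le_exp_cgf_norm hsymm hint z
  have hpow := norm_le_rpow_of_zeros_nonpos hg hg0 hgzeros hgrowth' hbound (sq_pos_of_pos hs)
    (pow_le_pow_left₀ hs.le hst 2)
  rwa [hgmgf, hgmgf] at hpow

end Symmetric

section UniformBound

variable {Ω : Type*} [MeasurableSpace Ω] {P : Measure Ω} {X : Ω → ℝ}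

theorem memLp_two_exp_mul (hint : ∀ t, Integrable (fun ω => Real.exp (t * X ω)) P) (t : ℝ) :
    MemLp (fun ω => Real.exp (t * X ω)) 2 P := by
  rw [memLp_two_iff_integrable_sq (hint t).aestronglyMeasurable]
  refine (hint (2 * t)).congr (ae_of_all _ fun ω => ?_)
  simp only [← Real.exp_nat_mul]
  ring_nf

theorem sq_mgf_sub_le_mgf_two_mul_mul_measureReal_lt [IsProbabilityMeasure P]
    (hint : ∀ t, Integrable (fun ω => Real.exp (t * X ω)) P) {t θ : ℝ} (hθ : 0 ≤ θ)
    (hθt : θ ≤ mgf X P t) :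
    (mgf X P t - θ) ^ 2 ≤ mgf X P (2 * t) * P.real {ω | θ < Real.exp (t * X ω)} := by
  refine (sq_integral_sub_le_integral_sq_mul_measureReal_lt (memLp_two_exp_mul hint t) hθ
    hθt).trans_eq ?_
  simp_rw [mgf, ← Real.exp_nat_mul, mul_assoc]
  norm_cast

theorem mgf_le_two_of_measureReal_lt [IsProbabilityMeasure P]
    (hint : ∀ t, Integrable (fun ω => Real.exp (t * X ω)) P)
    (hdouble : ∀ s, 0 < s → mgf X P (2 * s) ≤ mgf X P s ^ 4) {K : ℝ} (hK : 0 < K)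
    (htail : P.real {ω | K ≤ X ω} < 1 / 64) : mgf X P (1 / (3 * K)) ≤ 2 := by
  by_contra! hlt
  have hK3 : 0 < 1 / (3 * K) := by positivity
  have hcont : Continuous (mgf X P) := continuous_mgf hint
  obtain ⟨s, ⟨hs0, hsK⟩, hs⟩ := intermediate_value_Ioo hK3.le hcont.continuousOn
    (show (2 : ℝ) ∈ Set.Ioo (mgf X P 0) _ from ⟨by rw [mgf_zero]; norm_num, hlt⟩)
  -- The constants are `1 / 64 = (2 - 3 / 2) ^ 2 / 2 ^ 4` and `1 / 3 ≤ log (3 / 2)`.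
  have hPZ := sq_mgf_sub_le_mgf_two_mul_mul_measureReal_lt hint (t := s) (θ := 3 / 2)
    (by norm_num) (by rw [hs]; norm_num)
  have hmgf2 : mgf X P (2 * s) ≤ 16 := (hdouble s hs0).trans (by rw [hs]; norm_num)
  have hsub : {ω | 3 / 2 < Real.exp (s * X ω)} ⊆ {ω | K ≤ X ω} := fun ω hω => by
    have hlog : 1 / 3 < s * X ω := by
      have := Real.one_sub_inv_le_log_of_pos (show (0 : ℝ) < 3 / 2 by norm_num)
      have := (Real.log_lt_iff_lt_exp (by norm_num)).2 hω
      linarith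
    rw [lt_div_iff₀ (by positivity)] at hsK
    exact le_of_mul_le_mul_left (show s * K ≤ s * X ω by linarith) hs0
  have hmono : P.real {ω | 3 / 2 < Real.exp (s * X ω)} ≤ P.real {ω | K ≤ X ω} :=
    measureReal_mono hsub
  rw [hs] at hPZ
  nlinarith [measureReal_nonneg (μ := P) (s := {ω | 3 / 2 < Real.exp (s * X ω)})]

theorem mgf_le_two_mul_exp (hsymm : IdentDistrib X (-X) P P)
    (hint : ∀ t, Integrable (fun ω => Real.exp (t * X ω)) P) {s : ℝ} (hs : 0 < s)
    (hpow : ∀ t, s ≤ t → mgf X P t ≤ mgf X P s ^ (t ^ 2 / s ^ 2)) (hs2 : mgf X P s ≤ 2) (t : ℝ) :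
    mgf X P t ≤ 2 * Real.exp ((t / s) ^ 2) := by
  rcases le_total |t| s with hts | hts
  · calc mgf X P t ≤ mgf X P s := mgf_le_mgf_of_abs_le hsymm hint (by rwa [abs_of_pos hs])
      _ ≤ 2 * Real.exp ((t / s) ^ 2) := by
        linarith [Real.one_le_exp (sq_nonneg (t / s))]
  · have htwo : (2 : ℝ) ≤ Real.exp 1 := by linarith [Real.add_one_le_exp 1]
    calc mgf X P t ≤ mgf X P |t| := mgf_le_mgf_of_abs_le hsymm hint (abs_abs t).ge
      _ ≤ mgf X P s ^ (|t| ^ 2 / s ^ 2) := hpow _ hts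
      _ ≤ Real.exp 1 ^ (|t| ^ 2 / s ^ 2) := by
        gcongr
        exacts [mgf_nonneg, hs2.trans htwo]
      _ = Real.exp ((t / s) ^ 2) := by rw [Real.exp_one_rpow, sq_abs, div_pow]
      _ ≤ 2 * Real.exp ((t / s) ^ 2) := by linarith [Real.exp_pos ((t / s) ^ 2)]

end UniformBound

section GaussianLinearization

variable {Ω : Type*} [MeasurableSpace Ω] {P : Measure Ω} {X : Ω → ℝ}

theorem integral_exp_mul_gaussianReal (x : ℝ) :
    ∫ s, Real.exp (x * s) ∂(gaussianReal 0 1) = Real.exp (x ^ 2 / 2) := by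
  have h := congrFun (mgf_id_gaussianReal (μ := 0) (v := 1)) x
  simpa [mgf] using h

theorem lintegral_exp_sq_eq_lintegral_mgf [SFinite P] (hX : AEMeasurable X P)
    (hint : ∀ t, Integrable (fun ω => Real.exp (t * X ω)) P) (c : ℝ) :
    ∫⁻ ω, ENNReal.ofReal (Real.exp ((c * X ω) ^ 2 / 2)) ∂P =
      ∫⁻ s, ENNReal.ofReal (mgf X P (c * s)) ∂(gaussianReal 0 1) := by
  have hgauss (ω : Ω) : ENNReal.ofReal (Real.exp ((c * X ω) ^ 2 / 2)) =
      ∫⁻ s, ENNReal.ofReal (Real.exp (c * s * X ω)) ∂(gaussianReal 0 1) := by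
    rw [← integral_exp_mul_gaussianReal, ofReal_integral_eq_lintegral_ofReal
      (integrable_exp_mul_gaussianReal _) (ae_of_all _ fun _ => (Real.exp_pos _).le)]
    simp only [mul_right_comm]
  simp_rw [hgauss]
  rw [lintegral_lintegral_swap]
  · refine lintegral_congr fun s => ?_
    exact (ofReal_integral_eq_lintegral_ofReal (hint _)
      (ae_of_all _ fun _ => (Real.exp_pos _).le)).symm
  · have : AEMeasurable (fun p : Ω × ℝ => X p.1) (P.prod (gaussianReal 0 1)) := hX.comp_fst
    fun_prop

theorem lintegral_mul_exp_sq_div_four_gaussianReal_lt_top (C : ℝ) :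
    ∫⁻ s, ENNReal.ofReal (C * Real.exp (s ^ 2 / 4)) ∂(gaussianReal 0 1) < ⊤ := by
  have hint : Integrable (fun s => C * Real.exp (s ^ 2 / 4)) (gaussianReal 0 1) := by
    rw [gaussianReal_of_var_ne_zero 0 one_ne_zero,
      integrable_withDensity_iff (measurable_gaussianPDF 0 1)
        (ae_of_all _ fun _ => gaussianPDF_lt_top)]
    refine ((integrable_exp_neg_mul_sq (b := 1 / 4) (by norm_num)).const_mul
      (C * (Real.sqrt (2 * Real.pi))⁻¹)).congr (ae_of_all _ fun s => ?_)
    simp only [toReal_gaussianPDF, gaussianPDFReal, NNReal.coe_one, mul_one, sub_zero]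
    rw [mul_mul_mul_comm, ← Real.exp_add]
    ring_nf
  exact hint.lintegral_lt_top

theorem lintegral_exp_sq_le_of_mgf_le [SFinite P] (hX : AEMeasurable X P)
    (hint : ∀ t, Integrable (fun ω => Real.exp (t * X ω)) P) {C σ : ℝ} (hσ : σ ≠ 0)
    (hmgf : ∀ t, mgf X P t ≤ C * Real.exp ((t / σ) ^ 2)) :
    ∫⁻ ω, ENNReal.ofReal (Real.exp (σ ^ 2 / 8 * X ω ^ 2)) ∂P ≤
      ∫⁻ s, ENNReal.ofReal (C * Real.exp (s ^ 2 / 4)) ∂(gaussianReal 0 1) := by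
  calc ∫⁻ ω, ENNReal.ofReal (Real.exp (σ ^ 2 / 8 * X ω ^ 2)) ∂P
      = ∫⁻ ω, ENNReal.ofReal (Real.exp ((σ / 2 * X ω) ^ 2 / 2)) ∂P := by ring_nf
    _ = ∫⁻ s, ENNReal.ofReal (mgf X P (σ / 2 * s)) ∂(gaussianReal 0 1) :=
      lintegral_exp_sq_eq_lintegral_mgf hX hint _
    _ ≤ ∫⁻ s, ENNReal.ofReal (C * Real.exp (s ^ 2 / 4)) ∂(gaussianReal 0 1) :=
      lintegral_mono fun s => ENNReal.ofReal_le_ofReal ((hmgf _).trans_eq (by field_simp; norm_num))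

end GaussianLinearization

section SymmetricUniformBound

variable {Ω : Type*} [MeasurableSpace Ω] {P : Measure Ω} [IsProbabilityMeasure P] {X : Ω → ℝ}

theorem lintegral_exp_sq_le_of_complexMGF_zeros_imaginary (hsymm : IdentDistrib X (-X) P P)
    (hint : ∀ t, Integrable (fun ω => Real.exp (t * X ω)) P)
    (hgrowth : cgf X P =o[atTop] fun t => t ^ 4)
    (hzeros : ∀ z, complexMGF X P z = 0 → z.re = 0) {K : ℝ} (hK : 0 < K)
    (htail : P.real {ω | K ≤ X ω} < 1 / 64) :
    ∫⁻ ω, ENNReal.ofReal (Real.exp ((1 / (3 * K)) ^ 2 / 8 * X ω ^ 2)) ∂P ≤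
      ∫⁻ s, ENNReal.ofReal (2 * Real.exp (s ^ 2 / 4)) ∂(gaussianReal 0 1) := by
  have hpow {s t : ℝ} (hs : 0 < s) (hst : s ≤ t) : mgf X P t ≤ mgf X P s ^ (t ^ 2 / s ^ 2) :=
    mgf_le_rpow_of_complexMGF_zeros_imaginary hsymm hint hgrowth hzeros hs hst
  have hdouble (s : ℝ) (hs : 0 < s) : mgf X P (2 * s) ≤ mgf X P s ^ 4 := by
    have hratio : (2 * s) ^ 2 / s ^ 2 = (4 : ℕ) := by
      field_simp
      norm_num
    rw [← Real.rpow_natCast, ← hratio]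
    exact hpow hs (by linarith)
  have hσ : 0 < 1 / (3 * K) := by positivity
  exact lintegral_exp_sq_le_of_mgf_le hsymm.aemeasurable_fst hint hσ.ne'
    (mgf_le_two_mul_exp hsymm hint hσ (fun _ => hpow hσ)
      (mgf_le_two_of_measureReal_lt hint hdouble hK htail))

end SymmetricUniformBound

section SubGaussian

variable {Ω : Type*} [MeasurableSpace Ω] {P : Measure Ω} {X : Ω → ℝ} {b : ℝ}

theorem integrable_exp_mul_sq_of_lintegral_lt_top (hX : AEMeasurable X P)
    (hfin : ∫⁻ ω, ENNReal.ofReal (Real.exp (b * X ω ^ 2)) ∂P < ⊤) :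
    Integrable (fun ω => Real.exp (b * X ω ^ 2)) P :=
  (lintegral_ofReal_ne_top_iff_integrable (by fun_prop)
    (ae_of_all _ fun _ => (Real.exp_pos _).le)).1 hfin.ne

theorem exp_mul_le_exp_sq_div_mul_exp_mul_sq (hb : 0 < b) (t x : ℝ) :
    Real.exp (t * x) ≤ Real.exp (t ^ 2 / (4 * b)) * Real.exp (b * x ^ 2) := by
  rw [← Real.exp_add, Real.exp_le_exp]
  have hsq : t ^ 2 / (4 * b) + b * x ^ 2 - t * x = (t - 2 * b * x) ^ 2 / (4 * b) := by
    field_simp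
    ring
  linarith [show 0 ≤ (t - 2 * b * x) ^ 2 / (4 * b) by positivity]

theorem integrable_exp_mul_of_integrable_exp_mul_sq (hX : AEMeasurable X P) (hb : 0 < b)
    (hint : Integrable (fun ω => Real.exp (b * X ω ^ 2)) P) (t : ℝ) :
    Integrable (fun ω => Real.exp (t * X ω)) P := by
  refine (hint.const_mul (Real.exp (t ^ 2 / (4 * b)))).mono' (by fun_prop)
    (ae_of_all _ fun ω => ?_)
  rw [Real.norm_of_nonneg (Real.exp_pos _).le]
  exact exp_mul_le_exp_sq_div_mul_exp_mul_sq hb t (X ω)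

theorem cgf_isLittleO_pow_four_of_integrable_exp_mul_sq [IsProbabilityMeasure P]
    (hsymm : IdentDistrib X (-X) P P) (hb : 0 < b)
    (hint : Integrable (fun ω => Real.exp (b * X ω ^ 2)) P) :
    cgf X P =o[atTop] fun t => t ^ 4 := by
  have hexp := integrable_exp_mul_of_integrable_exp_mul_sq hsymm.aemeasurable_fst hb hint
  set L := Real.log (∫ ω, Real.exp (b * X ω ^ 2) ∂P)
  have hpos : 0 < ∫ ω, Real.exp (b * X ω ^ 2) ∂P := integral_exp_pos hint
  have hcgf_nonneg (t : ℝ) : 0 ≤ cgf X P t := Real.log_nonneg <| by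
    simpa only [mgf_zero] using mgf_le_mgf_of_abs_le hsymm hexp (s := 0) (t := t) (by simp)
  have hcgf_le (t : ℝ) : cgf X P t ≤ (4 * b)⁻¹ * t ^ 2 + L := by
    have hmgf : mgf X P t ≤ Real.exp (t ^ 2 / (4 * b)) * ∫ ω, Real.exp (b * X ω ^ 2) ∂P := by
      rw [← integral_const_mul]
      exact integral_mono (hexp t) (hint.const_mul _)
        fun ω => exp_mul_le_exp_sq_div_mul_exp_mul_sq hb t (X ω)
    rw [← Real.exp_log hpos, ← Real.exp_add] at hmgf
    calc cgf X P t ≤ t ^ 2 / (4 * b) + L :=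
          (Real.log_le_iff_le_exp (mgf_pos (hexp t))).2 hmgf
      _ = (4 * b)⁻¹ * t ^ 2 + L := by rw [div_eq_inv_mul]
  have hsq : (fun t : ℝ => t ^ 2) =o[atTop] fun t => t ^ 4 :=
    Asymptotics.isLittleO_pow_pow_atTop_of_lt (by norm_num)
  have hconst : (fun _ : ℝ => L) =o[atTop] fun t : ℝ => t ^ 4 :=
    Asymptotics.isLittleO_const_left.2 (Or.inr (tendsto_norm_atTop_atTop.comp
      (tendsto_pow_atTop four_ne_zero)))
  refine Asymptotics.IsBigO.trans_isLittleO (.of_norm_le fun t => ?_)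
    ((hsq.const_mul_left (4 * b)⁻¹).add hconst)
  rw [Real.norm_of_nonneg (hcgf_nonneg t)]
  exact hcgf_le t

end SubGaussian

section WeakConvergence

variable {ι : Type*} {l : Filter ι} {Ω : ι → Type*} {Ω' E : Type*}
  [∀ i, MeasurableSpace (Ω i)] [MeasurableSpace Ω'] {P : ∀ i, Measure (Ω i)}
  [∀ i, IsProbabilityMeasure (P i)] {P' : Measure Ω'} [IsProbabilityMeasure P']
  [TopologicalSpace E] [MeasurableSpace E] [OpensMeasurableSpace E] [HasOuterApproxClosed E]
  {X : ∀ i, Ω i → E} {Y : Ω' → E}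

theorem eventually_measure_lt_of_tendstoInDistribution (h : TendstoInDistribution X l Y P P')
    {F : Set E} (hF : IsClosed F) {ε : ENNReal} (hε : P' (Y ⁻¹' F) < ε) :
    ∀ᶠ i in l, P i (X i ⁻¹' F) < ε := by
  rw [← Measure.map_apply_of_aemeasurable h.aemeasurable_limit hF.measurableSet] at hε
  filter_upwards [eventually_lt_of_limsup_lt
    ((ProbabilityMeasure.limsup_measure_closed_le_of_tendsto h.tendsto hF).trans_lt hε)] with i hi
  exact (Measure.le_map_apply (h.forall_aemeasurable i) F).trans_lt hi

theorem lintegral_le_of_tendstoInDistribution_of_frequently_le [l.IsCountablyGenerated]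
    (h : TendstoInDistribution X l Y P P') {f : E → ℝ} (hf : Continuous f) (hf0 : 0 ≤ f)
    {D : ENNReal} (hD : ∃ᶠ i in l, ∫⁻ ω, ENNReal.ofReal (f (X i ω)) ∂(P i) ≤ D) :
    ∫⁻ ω, ENNReal.ofReal (f (Y ω)) ∂P' ≤ D := by
  have hfm : Measurable fun x => ENNReal.ofReal (f x) := hf.measurable.ennreal_ofReal
  obtain ⟨ns, hns, hnsD⟩ := exists_seq_forall_of_frequently hD
  have hFatou := lintegral_le_liminf_lintegral_of_forall_isOpen_measure_le_liminf_measure hf hf0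
    fun G hG => ProbabilityMeasure.le_liminf_measure_open_of_tendsto (h.tendsto.comp hns) hG
  calc ∫⁻ ω, ENNReal.ofReal (f (Y ω)) ∂P'
      = ∫⁻ x, ENNReal.ofReal (f x) ∂(P'.map Y) :=
        (lintegral_map' hfm.aemeasurable h.aemeasurable_limit).symm
    _ ≤ liminf (fun k => ∫⁻ x, ENNReal.ofReal (f x) ∂((P (ns k)).map (X (ns k)))) atTop := hFatou
    _ ≤ D := liminf_le_of_frequently_le (Frequently.of_forall fun k => by
        rw [lintegral_map' hfm.aemeasurable (h.forall_aemeasurable _)]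
        exact hnsD k)

end WeakConvergence

theorem exists_measure_preimage_Ici_lt {Ω : Type*} [MeasurableSpace Ω] {P : Measure Ω}
    [IsFiniteMeasure P] {Y : Ω → ℝ} (hY : AEMeasurable Y P) {ε : ENNReal} (hε : 0 < ε) :
    ∃ K, 0 < K ∧ P (Y ⁻¹' Set.Ici K) < ε := by
  have htight := tendsto_measure_norm_gt_of_isTightMeasureSet
    (isTightMeasureSet_singleton (μ := P.map Y))
  simp only [Set.mem_singleton_iff, iSup_iSup_eq_left] at htight
  obtain ⟨r, hrε, hr⟩ := ((htight.eventually_lt_const hε).and (eventually_ge_atTop 0)).exists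
  refine ⟨r + 1, by linarith, (Measure.le_map_apply hY _).trans_lt (hrε.trans_le' ?_)⟩
  exact measure_mono fun x (hx : r + 1 ≤ x) => (lt_add_one r).trans_le (hx.trans (le_abs_self x))

theorem mainTheorem7_general {ι : Type*} {l : Filter ι} [l.IsCountablyGenerated]
    {Ω : ι → Type*} {Ω' : Type*} [∀ i, MeasurableSpace (Ω i)] [MeasurableSpace Ω']
    (P : ∀ i, Measure (Ω i)) [∀ i, IsProbabilityMeasure (P i)]
    (P' : Measure Ω') [IsProbabilityMeasure P'] (X : ∀ i, Ω i → ℝ) (Y : Ω' → ℝ)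
    (hsymm : ∀ i, IdentDistrib (X i) (-X i) (P i) (P i))
    (hint : ∀ i t, Integrable (fun ω => Real.exp (t * X i ω)) (P i))
    (hgrowth : ∀ i, cgf (X i) (P i) =o[atTop] fun t => t ^ 4)
    (hlim : TendstoInDistribution X l Y P P')
    (hY : ∀ b : ℝ, 0 < b → ∫⁻ ω, ENNReal.ofReal (Real.exp (b * Y ω ^ 2)) ∂P' = ⊤) :
    ∀ᶠ i in l, ∃ z : ℂ, z.re ≠ 0 ∧
      Integrable (fun ω => Complex.exp (z * (X i ω : ℂ))) (P i) ∧
      complexMGF (X i) (P i) z = 0 := by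
  obtain ⟨K, hK, hKtail⟩ := exists_measure_preimage_Ici_lt hlim.aemeasurable_limit
    (ε := ENNReal.ofReal (1 / 64)) (by norm_num)
  by_contra hcon
  have hfreq := (not_eventually.1 hcon).and_eventually
    (eventually_measure_lt_of_tendstoInDistribution hlim isClosed_Ici hKtail)
  have hlimit := lintegral_le_of_tendstoInDistribution_of_frequently_le hlim
    (f := fun x => Real.exp ((1 / (3 * K)) ^ 2 / 8 * x ^ 2)) (by fun_prop)
    (fun _ => (Real.exp_pos _).le) <| hfreq.mono fun i ⟨hi, htail⟩ =>
      lintegral_exp_sq_le_of_complexMGF_zeros_imaginary (hsymm i) (hint i) (hgrowth i)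
        (fun z hz => by_contra fun hre => hi ⟨z, hre,
          integrable_cexp_mul_of_re_mem_integrableExpSet (hlim.forall_aemeasurable i)
            (hint i z.re), hz⟩)
        hK (ENNReal.toReal_lt_of_lt_ofReal htail)
  rw [hY _ (by positivity)] at hlimit
  exact (lintegral_mul_exp_sq_div_four_gaussianReal_lt_top 2).not_ge hlimit

theorem mainTheorem7
    {Ω : ℕ → Type*} {Ω' : Type*}
    [∀ n, MeasurableSpace (Ω n)] [MeasurableSpace Ω']
    (P : ∀ n, Measure (Ω n)) [∀ n, IsProbabilityMeasure (P n)]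
    (P' : Measure Ω') [IsProbabilityMeasure P']
    (X : ∀ n, Ω n → ℝ) (Y : Ω' → ℝ)
    (hsymm : ∀ n, IdentDistrib (X n) (-X n) (P n) (P n))
    (hsub : ∀ n, ∃ b : ℝ, 0 < b ∧
      ∫⁻ ω, ENNReal.ofReal (Real.exp (b * X n ω ^ 2)) ∂(P n) < ⊤)
    (hlim : TendstoInDistribution X atTop Y P P')
    (hY : ∀ b : ℝ, 0 < b →
      ∫⁻ ω, ENNReal.ofReal (Real.exp (b * Y ω ^ 2)) ∂P' = ⊤) :
    ∀ᶠ n in atTop, ∃ z : ℂ, z.re ≠ 0 ∧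
      Integrable (fun ω => Complex.exp (z * (X n ω : ℂ))) (P n) ∧
      complexMGF (X n) (P n) z = 0 := by
  choose b hb hfin using hsub
  have hint (n) := integrable_exp_mul_sq_of_lintegral_lt_top (hsymm n).aemeasurable_fst (hfin n)
  exact mainTheorem7_general P P' X Y hsymm
    (fun n => integrable_exp_mul_of_integrable_exp_mul_sq (hsymm n).aemeasurable_fst (hb n)
      (hint n))
    (fun n => cgf_isLittleO_pow_four_of_integrable_exp_mul_sq (hsymm n) (hb n) (hint n))
    hlim hY
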